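/- For a positive integer $N$ let $\zeta_N=\exp(2\pi i/N)$, and put $\alpha=\zeta_3$, $\beta=\zeta_5$, $\gamma=\zeta_7$. Let $f(x,y)=1+x+y+x^2y^3+x^3y^2+x^3y^3$. Define $$S_0=\{(1,-1),(-1,1)\},$$ $$S_1=\{(\alpha,\alpha),(\alpha^2,\alpha),(\alpha,\alpha^2),(\alpha^2,\alpha^2),(\alpha,-\alpha),(-\alpha,\alpha),(\alpha^2,-\alpha^2),(-\alpha^2,\alpha^2)\},$$ $$S_2=\{(\beta^k\alpha,\beta^k\alpha^2):1\le k\le 4\}\cup\{(\beta^k\alpha^2,\beta^k\alpha):1\le k\le 4\},$$ $$S_3=\{(\gamma,-\gamma^4),(\gamma^2,-\gamma),(\gamma^3,-\gamma^5),(\gamma^4,-\gamma^2),(\gamma^5,-\gamma^6),(\gamma^6,-\gamma^3),$$ $$(-\gamma,\gamma^2),(-\gamma^2,\gamma^4),(-\gamma^3,\gamma^6),(-\gamma^4,\gamma),(-\gamma^5,\gamma^3),(-\gamma^6,\gamma^5)\},$$ and $S=S_0\cup S_1\cup S_2\cup S_3$. **Theorem.** The set of all pairs $(x,y)\in\mathbb{C}^2$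 such that $f(x,y)=0$ and $x^N=y^N=1$ for some positive integer $N$ is equal to $S$, and $|S|=30$. Moreover, this set is equal to $\{(\zeta_{210}^a,\zeta_{210}^b):(a,b)\in P\}$, where $P$ is the set of $30$ pairs consisting of $(70,70)$, $(140,140)$, the fourteen pairs $$(0,105),(14,154),(15,30),(28,98),(35,140),(45,90),(56,196),$$ $$(60,135),(70,140),(70,175),(75,150),(112,182),(120,165),(180,195),$$ and the fourteen pairs $(b,a)$ obtained from these by exchanging the two entries. -/

import Mathlib

namespace Sharygin

/-- The standard primitive `N`-th root of unity `exp(2πi/N)` (used for `N ≥ 1`). -/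
noncomputable def zeta (N : ℕ) : ℂ := Complex.exp (2 * Real.pi * Complex.I / N)

/-- The polynomial `f(x, y) = 1 + x + y + x²y³ + x³y² + x³y³`. -/
def f (x y : ℂ) : ℂ := 1 + x + y + x ^ 2 * y ^ 3 + x ^ 3 * y ^ 2 + x ^ 3 * y ^ 3

/-- Solutions of `f(x, y) = 0` with `x ^ N = y ^ N = 1` for some positive integer `N`. -/
def solutions : Set (ℂ × ℂ) :=
  {p | f p.1 p.2 = 0 ∧ ∃ N : ℕ, 0 < N ∧ p.1 ^ N = 1 ∧ p.2 ^ N = 1}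

noncomputable def α : ℂ := zeta 3

noncomputable def β : ℂ := zeta 5

noncomputable def γ : ℂ := zeta 7

def S₀ : Set (ℂ × ℂ) := {(1, -1), (-1, 1)}

def S₁ : Set (ℂ × ℂ) :=
  {(α, α), (α ^ 2, α), (α, α ^ 2), (α ^ 2, α ^ 2),
   (α, -α), (-α, α), (α ^ 2, -α ^ 2), (-α ^ 2, α ^ 2)}

def S₂ : Set (ℂ × ℂ) :=
  {(β * α, β * α ^ 2), (β ^ 2 * α, β ^ 2 * α ^ 2),
   (β ^ 3 * α, β ^ 3 * α ^ 2), (β ^ 4 * α, β ^ 4 * α ^ 2),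
   (β * α ^ 2, β * α), (β ^ 2 * α ^ 2, β ^ 2 * α),
   (β ^ 3 * α ^ 2, β ^ 3 * α), (β ^ 4 * α ^ 2, β ^ 4 * α)}

def S₃ : Set (ℂ × ℂ) :=
  {(γ, -γ ^ 4), (γ ^ 2, -γ), (γ ^ 3, -γ ^ 5),
   (γ ^ 4, -γ ^ 2), (γ ^ 5, -γ ^ 6), (γ ^ 6, -γ ^ 3),
   (-γ, γ ^ 2), (-γ ^ 2, γ ^ 4), (-γ ^ 3, γ ^ 6),
   (-γ ^ 4, γ), (-γ ^ 5, γ ^ 3), (-γ ^ 6, γ ^ 5)}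

def S : Set (ℂ × ℂ) := S₀ ∪ S₁ ∪ S₂ ∪ S₃

/-- One representative of each pair of exponents `(a, b)`, `(b, a)` with `a ≠ b`. -/
def PHalf : Finset (ℕ × ℕ) :=
  {(0, 105), (14, 154), (15, 30), (28, 98), (35, 140), (45, 90), (56, 196),
   (60, 135), (70, 140), (70, 175), (75, 150), (112, 182), (120, 165), (180, 195)}

/-- The exponents: two diagonal pairs, and the pairs above together with the symmetric ones. -/
def P : Finset (ℕ × ℕ) :=
  {(70, 70), (140, 140)} ∪ PHalf ∪ PHalf.image Prod.swap

end Sharygin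

/-!
Let `x, y` be roots of unity with `f x y = 0`. Conjugating over `ℚ` by `ζ ↦ ζ ^ k`, with `k` chosen
according to the residue modulo `4` of the order of `(x, y)`, produces a second zero of `f`: either
`(±x, ±y) ≠ (x, y)`, or `(±x ^ 2, ±y ^ 2)` (Beukers and Smyth). Since `f` depends only on
`s = x + y` and `p = x * y`, and is affine in `s`, eliminating `s` between the two equations leaves
a polynomial in `p` which is a product of cyclotomic polynomials and forces the order of `p` to be
`1`, `2`, `3`, `5`, `6` or `14`; as `1 + p ^ 2 ≠ 0`, this `p` then determines `s` and hence
`{x, y}`.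

The elimination yields a non-cyclotomic polynomial only for `(-x ^ 2, -y ^ 2)`. There `p` has odd
order, so `p` and `p ^ 2` are both zeros of the same reciprocal octic. In terms of the trace
`c = p + p⁻¹` this says that `c` and `c ^ 2 - 2` are zeros of the same quartic, which is impossible.
-/

namespace Sharygin

section Conjugation

variable {K σ : Type*} [CommRing K] [IsDomain K]

lemma aeval_pow_eq_zero [CharZero K] {ζ : K} (hζ : IsOfFinOrder ζ) {k : ℕ}
    (hk : k.Coprime (orderOf ζ)) {Q : Polynomial ℤ} (hQ : Polynomial.aeval ζ Q = 0) :
    Polynomial.aeval (ζ ^ k) Q = 0 := by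
  have hprim := IsPrimitiveRoot.orderOf ζ
  refine Polynomial.aeval_eq_zero_of_dvd_aeval_eq_zero
    (minpoly.isIntegrallyClosed_dvd (hprim.isIntegral hζ.orderOf_pos) hQ) ?_
  rw [hprim.minpoly_eq_pow_coprime hk, minpoly.aeval]

lemma exists_eq_pow_of_isOfFinOrder {z : σ → K} (hz : IsOfFinOrder z) :
    ∃ (ζ : K) (a : σ → ℕ), orderOf ζ ∣ orderOf z ∧ z = fun i ↦ ζ ^ a i := by
  have : NeZero (orderOf z) := ⟨hz.orderOf_pos.ne'⟩
  obtain ⟨g, hg⟩ := IsCyclic.exists_generator (α := rootsOfUnity (orderOf z) K)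
  have hz_pow (i : σ) : z i ^ orderOf z = 1 := congrFun (pow_orderOf_eq_one z) i
  have hz_mem (i : σ) : ∃ n : ℕ, g ^ n = rootsOfUnity.mkOfPowEq (z i) (hz_pow i) :=
    mem_powers_iff_mem_zpowers.mpr (hg _)
  choose a ha using hz_mem
  refine ⟨(g : Kˣ), a, orderOf_dvd_of_pow_eq_one ?_, funext fun i ↦ ?_⟩
  · exact (mem_rootsOfUnity' _ _).mp g.2
  · simpa using (congrArg (fun u : rootsOfUnity (orderOf z) K ↦ ((u : Kˣ) : K)) (ha i)).symm

lemma mvPolynomial_aeval_pow_eq_zero [CharZero K] {z : σ → K} (hz : IsOfFinOrder z) {k : ℕ}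
    (hk : k.Coprime (orderOf z)) {P : MvPolynomial σ ℤ} (hP : MvPolynomial.aeval z P = 0) :
    MvPolynomial.aeval (z ^ k) P = 0 := by
  obtain ⟨ζ, a, hdvd, ha⟩ := exists_eq_pow_of_isOfFinOrder hz
  let Q : Polynomial ℤ := MvPolynomial.aeval (fun i ↦ Polynomial.X ^ a i) P
  have hQ (w : K) : Polynomial.aeval w Q = MvPolynomial.aeval (fun i ↦ w ^ a i) P := by
    simp [Q, MvPolynomial.comp_aeval_apply]
  have hζ : IsOfFinOrder ζ := orderOf_pos_iff.mp (Nat.pos_of_dvd_of_pos hdvd hz.orderOf_pos)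
  have hzk : z ^ k = fun i ↦ (ζ ^ k) ^ a i := by
    ext i
    simp [ha, pow_right_comm]
  rw [hzk, ← hQ]
  exact aeval_pow_eq_zero hζ (hk.coprime_dvd_right hdvd) (by rw [hQ, ← ha, hP])

theorem exists_sign_twist_aeval_eq_zero [CharZero K] {z : σ → K} (hz : IsOfFinOrder z)
    {P : MvPolynomial σ ℤ} (hP : MvPolynomial.aeval z P = 0) :
    ∃ ε : σ → K, ε ^ 2 = 1 ∧
      (ε ≠ 1 ∧ MvPolynomial.aeval (ε * z) P = 0 ∨
        (∃ m, Odd m ∧ z ^ m = ε) ∧ MvPolynomial.aeval (ε * z ^ 2) P = 0) := by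
  have conj {k : ℕ} (hk : k.Coprime (orderOf z)) := mvPolynomial_aeval_pow_eq_zero hz hk hP
  rcases Nat.even_or_odd' (orderOf z) with ⟨m, hm | hm⟩
  · have hsq : (z ^ m) ^ 2 = 1 := by rw [← pow_mul', ← hm, pow_orderOf_eq_one]
    refine ⟨z ^ m, hsq, ?_⟩
    rw [← pow_succ, ← pow_add]
    rcases Nat.even_or_odd m with hm_even | hm_odd
    · refine Or.inl ⟨fun h ↦ ?_, conj ?_⟩
      · have := hz.orderOf_pos
        have := Nat.le_of_dvd (by omega) (orderOf_dvd_of_pow_eq_one h)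
        omega
      · rw [hm]
        exact Nat.Coprime.mul_right (Nat.coprime_two_right.mpr hm_even.add_one) (by simp)
    · refine Or.inr ⟨⟨m, hm_odd, rfl⟩, conj ?_⟩
      rw [hm]
      exact Nat.Coprime.mul_right (Nat.coprime_two_right.mpr (hm_odd.add_even even_two))
        (by simpa using Nat.coprime_two_left.mpr hm_odd)
  · refine ⟨1, one_pow 2, Or.inr ⟨⟨orderOf z, ⟨m, hm⟩, pow_orderOf_eq_one z⟩, ?_⟩⟩
    rw [one_mul]
    exact conj (Nat.coprime_two_left.mpr ⟨m, hm⟩)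

end Conjugation

lemma isPrimitiveRoot_iff_geom_sum_eq_zero {R : Type*} [CommRing R] [IsDomain R] {p : ℕ}
    [Fact p.Prime] [NeZero (p : R)] {x : R} :
    IsPrimitiveRoot x p ↔ ∑ i ∈ Finset.range p, x ^ i = 0 := by
  rw [← Polynomial.isRoot_cyclotomic_iff, Polynomial.cyclotomic_prime]
  simp [Polynomial.IsRoot, Polynomial.eval_geom_sum]

lemma isPrimitiveRoot_iff_exists_pow_eq {R : Type*} [CommRing R] [IsDomain R] {ζ x : R}
    {N d n : ℕ} [NeZero N] (hζ : IsPrimitiveRoot ζ N) (hN : N = d * n) :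
    IsPrimitiveRoot x n ↔ ∃ i < n, i.Coprime n ∧ ζ ^ (d * i) = x := by
  have : NeZero n := ⟨right_ne_zero_of_mul (hN ▸ NeZero.ne N)⟩
  simp only [pow_mul, (hζ.pow (NeZero.pos N) hN).isPrimitiveRoot_iff]

lemma isPrimitiveRoot_three_iff {R : Type*} [CommRing R] [IsDomain R] [CharZero R] {x : R} :
    IsPrimitiveRoot x 3 ↔ x ^ 2 + x + 1 = 0 := by
  rw [isPrimitiveRoot_iff_geom_sum_eq_zero]
  simp only [Finset.sum_range_succ, Finset.sum_range_zero]
  ring_nf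

lemma isPrimitiveRoot_five_iff {R : Type*} [CommRing R] [IsDomain R] [CharZero R] {x : R} :
    IsPrimitiveRoot x 5 ↔ x ^ 4 + x ^ 3 + x ^ 2 + x + 1 = 0 := by
  have := Fact.mk Nat.prime_five
  rw [isPrimitiveRoot_iff_geom_sum_eq_zero]
  simp only [Finset.sum_range_succ, Finset.sum_range_zero]
  ring_nf

lemma isPrimitiveRoot_seven_iff {R : Type*} [CommRing R] [IsDomain R] [CharZero R] {x : R} :
    IsPrimitiveRoot x 7 ↔ x ^ 6 + x ^ 5 + x ^ 4 + x ^ 3 + x ^ 2 + x + 1 = 0 := by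
  have := Fact.mk Nat.prime_seven
  rw [isPrimitiveRoot_iff_geom_sum_eq_zero]
  simp only [Finset.sum_range_succ, Finset.sum_range_zero]
  ring_nf

lemma f_eq (x y : ℂ) : f x y = (x + y) * (1 + (x * y) ^ 2) + (1 + (x * y) ^ 3) := by
  unfold f; ring

lemma f_comm (x y : ℂ) : f x y = f y x := by unfold f; ring

lemma one_add_mul_sq_ne_zero {x y : ℂ} (h : f x y = 0) : 1 + (x * y) ^ 2 ≠ 0 := by
  intro hsq
  rw [f_eq] at h
  have hp : x * y = 1 := by linear_combination (x + y + x * y) * hsq - h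
  norm_num [hp] at hsq

/-- The torsion zeros of `f`, listed in parametric form. The case `neg` covers `S₀` and half
of `S₁`; the last three are named after the orders of the roots of unity parametrising them. -/
inductive TorsionZero : ℂ → ℂ → Prop
  | neg {x : ℂ} (hx : x ^ 6 = 1) : TorsionZero x (-x)
  | diag {x : ℂ} (hx : IsPrimitiveRoot x 3) : TorsionZero x x
  | sq {x : ℂ} (hx : IsPrimitiveRoot x 3) : TorsionZero x (x ^ 2)
  | five_three {u w : ℂ} (hu : IsPrimitiveRoot u 5) (hw : IsPrimitiveRoot w 3) :
      TorsionZero (u * w) (u * w ^ 2)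
  | seven_left {x : ℂ} (hx : IsPrimitiveRoot x 7) : TorsionZero x (-x ^ 4)
  | seven_right {y : ℂ} (hy : IsPrimitiveRoot y 7) : TorsionZero (-y ^ 4) y

lemma TorsionZero.f_eq_zero {x y : ℂ} (h : TorsionZero x y) : f x y = 0 := by
  rw [f_eq]
  cases h with
  | neg hx => linear_combination -hx
  | diag hx =>
    have h3 := hx.pow_eq_one
    rw [isPrimitiveRoot_three_iff] at hx
    linear_combination (2 * x ^ 2 + x ^ 3 + 1) * h3 + 2 * hx
  | sq hx =>
    have h3 := hx.pow_eq_one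
    rw [isPrimitiveRoot_three_iff] at hx
    rw [← pow_succ', h3]
    linear_combination 2 * hx
  | @five_three u w hu hw =>
    have h5 := hu.pow_eq_one
    have h3 := hw.pow_eq_one
    rw [isPrimitiveRoot_three_iff] at hw
    have hs : u * w + u * w ^ 2 = -u := by linear_combination u * hw
    have hp : u * w * (u * w ^ 2) = u ^ 2 := by linear_combination u ^ 2 * h3
    rw [hs, hp]
    linear_combination (u - 1) * h5
  | seven_left hx =>
    linear_combination (x ^ 4 - (1 + x) * (x ^ 7 + 1)) * hx.pow_eq_one
  | seven_right hy =>
    linear_combination (y ^ 4 - (1 + y) * (y ^ 7 + 1)) * hy.pow_eq_one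

lemma torsionZero_of_mul_eq_one {x y : ℂ} (h : f x y = 0) (hp : x * y = 1) : TorsionZero x y := by
  rw [f_eq, hp] at h
  have hs : x + y = -1 := by linear_combination h / 2
  have hx : x ^ 2 + x + 1 = 0 := by linear_combination x * hs - hp
  obtain rfl : y = x ^ 2 := by linear_combination hs - hx
  exact .sq (isPrimitiveRoot_three_iff.mpr hx)

lemma torsionZero_of_mul_pow_three_eq_neg_one {x y : ℂ} (h : f x y = 0) (hp : (x * y) ^ 3 = -1) :
    TorsionZero x y := by
  have hs : x + y = 0 := by
    refine (mul_eq_zero.mp ?_).resolve_right (one_add_mul_sq_ne_zero h)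
    rw [f_eq] at h
    linear_combination h - hp
  obtain rfl : y = -x := by linear_combination hs
  exact .neg (by linear_combination -hp)

lemma torsionZero_of_isPrimitiveRoot_mul_three {x y : ℂ} (h : f x y = 0)
    (hp : IsPrimitiveRoot (x * y) 3) : TorsionZero x y := by
  have h3 := hp.pow_eq_one
  have hp_sq : IsPrimitiveRoot ((x * y) ^ 2) 3 := hp.pow_of_coprime 2 (by norm_num)
  rw [isPrimitiveRoot_three_iff] at hp
  have hs : x + y = 2 * (x * y) ^ 2 := by
    refine mul_right_cancel₀ (one_add_mul_sq_ne_zero h) ?_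
    rw [f_eq] at h
    linear_combination h - (1 + 2 * (x * y)) * h3 - 2 * hp
  have hx : x = (x * y) ^ 2 := by
    have : (x - (x * y) ^ 2) ^ 2 = 0 := by linear_combination x * hs + (x * y) * h3
    exact sub_eq_zero.mp (pow_eq_zero_iff two_ne_zero |>.mp this)
  obtain rfl : y = x := by linear_combination hs - 2 * hx
  exact .diag (hx ▸ hp_sq)

lemma torsionZero_of_isPrimitiveRoot_mul_five {x y : ℂ} (h : f x y = 0)
    (hp : IsPrimitiveRoot (x * y) 5) : TorsionZero x y := by
  have h5 := hp.pow_eq_one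
  have hu : IsPrimitiveRoot ((x * y) ^ 3) 5 := hp.pow_of_coprime 3 (by norm_num)
  have hs : x + y = -(x * y) ^ 3 := by
    refine mul_right_cancel₀ (one_add_mul_sq_ne_zero h) ?_
    rw [f_eq] at h
    linear_combination h + h5
  have hw : IsPrimitiveRoot (x * (x * y) ^ 2) 3 := isPrimitiveRoot_three_iff.mpr (by
    linear_combination x * (x * y) ^ 4 * hs - (1 + x * (x * y) ^ 2) * h5)
  convert TorsionZero.five_three hu hw using 1
  · linear_combination -x * h5
  · linear_combination (1 - (x * y) ^ 7 * x) * hs + ((x * y) ^ 3 + x * ((x * y) ^ 5 + 1)) * h5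

lemma torsionZero_of_isPrimitiveRoot_neg_mul_seven {x y : ℂ} (h : f x y = 0)
    (hp : IsPrimitiveRoot (-(x * y)) 7) : TorsionZero x y := by
  have h7 : (x * y) ^ 7 = -1 := by linear_combination -hp.pow_eq_one
  have hroot : IsPrimitiveRoot (-(x * y) ^ 3) 7 := by
    convert hp.pow_of_coprime 3 (by norm_num) using 1
    ring
  have hs : x + y = (x * y) ^ 5 - (x * y) ^ 3 := by
    refine mul_right_cancel₀ (one_add_mul_sq_ne_zero h) ?_
    rw [f_eq] at h
    linear_combination h - h7
  have hfac : (x + (x * y) ^ 3) * (x - (x * y) ^ 5) = 0 := by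
    linear_combination x * hs - x * y * h7
  have hpow : (x * y) ^ 5 = -(-(x * y) ^ 3) ^ 4 := by linear_combination (x * y) ^ 5 * h7
  rcases mul_eq_zero.mp hfac with hx | hx
  · have hx : x = -(x * y) ^ 3 := by linear_combination hx
    have hy : y = -x ^ 4 := by rw [hx]; linear_combination hs - hx + hpow
    rw [hy]
    exact .seven_left (hx ▸ hroot)
  · have hy : y = -(x * y) ^ 3 := by linear_combination hs - hx
    have hx : x = -y ^ 4 := by rw [hy]; linear_combination hx + hpow
    rw [hx]
    exact .seven_right (hy ▸ hroot)

/-- The values taken by `x * y` at the torsion zeros `(x, y)` of `f`. The case `cube_neg_one` covers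
the orders `2` and `6`, and `fourteen` expresses order `14` through the order `7` of `-p`. -/
inductive TorsionZeroProduct (p : ℂ) : Prop
  | one (hp : p = 1)
  | cube_neg_one (hp : p ^ 3 = -1)
  | three (hp : IsPrimitiveRoot p 3)
  | five (hp : IsPrimitiveRoot p 5)
  | fourteen (hp : IsPrimitiveRoot (-p) 7)

lemma TorsionZeroProduct.torsionZero {x y : ℂ} (hp : TorsionZeroProduct (x * y))
    (h : f x y = 0) : TorsionZero x y := by
  cases hp with
  | one hp => exact torsionZero_of_mul_eq_one h hp
  | cube_neg_one hp => exact torsionZero_of_mul_pow_three_eq_neg_one h hp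
  | three hp => exact torsionZero_of_isPrimitiveRoot_mul_three h hp
  | five hp => exact torsionZero_of_isPrimitiveRoot_mul_five h hp
  | fourteen hp => exact torsionZero_of_isPrimitiveRoot_neg_mul_seven h hp

lemma torsionZeroProduct_of_f_neg_neg {x y : ℂ} (h : f x y = 0) (h' : f (-x) (-y) = 0) :
    TorsionZeroProduct (x * y) := by
  rw [f_eq] at h h'
  exact .cube_neg_one (by linear_combination (h + h') / 2)

lemma torsionZeroProduct_of_f_neg_right {x y : ℂ} (hy : y ≠ 0) (h : f x y = 0)
    (h' : f x (-y) = 0) : TorsionZeroProduct (x * y) := by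
  unfold f at h h'
  have h_even : 1 + x + x ^ 3 * y ^ 2 = 0 := by linear_combination (h + h') / 2
  have h_odd : 1 + x ^ 2 * y ^ 2 + x ^ 3 * y ^ 2 = 0 := by
    refine (mul_eq_zero.mp ?_).resolve_left hy
    linear_combination (h - h') / 2
  have hx : x ^ 2 + x + 1 = 0 := by linear_combination (1 + x) * h_even - x * h_odd
  have hxy : (y - x) * (y + x) = 0 := by
    linear_combination h_even - hx - y ^ 2 * (x - 1) * hx
  have hx_prim := isPrimitiveRoot_three_iff.mpr hx
  rcases mul_eq_zero.mp hxy with hy | hy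
  · obtain rfl : y = x := sub_eq_zero.mp hy
    exact .three (by simpa only [sq] using hx_prim.pow_of_coprime 2 (by norm_num))
  · obtain rfl : y = -x := eq_neg_of_add_eq_zero_left hy
    exact .cube_neg_one (by linear_combination (-x ^ 3 - 1) * hx_prim.pow_eq_one)

lemma torsionZeroProduct_of_f_sq_sq {x y : ℂ} (h : f x y = 0) (h' : f (x ^ 2) (y ^ 2) = 0) :
    TorsionZeroProduct (x * y) := by
  rw [f_eq] at h h'
  have hs : x ^ 2 + y ^ 2 = (x + y) ^ 2 - 2 * (x * y) := by ring
  rw [← mul_pow, hs] at h'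
  generalize x * y = p at *
  generalize x + y = s at *
  have hE : (p - 1) ^ 2 * ((p ^ 2 - p + 1) * ((p ^ 2 + p + 1) *
      (p ^ 4 + p ^ 3 + p ^ 2 + p + 1))) = 0 := by
    linear_combination (1 + p ^ 2) ^ 2 / 2 * h' -
      (1 + p ^ 4) * (s * (1 + p ^ 2) - (1 + p ^ 3)) / 2 * h
  rcases mul_eq_zero.mp hE with h1 | hE
  · exact .one (sub_eq_zero.mp (pow_eq_zero_iff two_ne_zero |>.mp h1))
  rcases mul_eq_zero.mp hE with h6 | hE
  · exact .cube_neg_one (by linear_combination (p + 1) * h6)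
  rcases mul_eq_zero.mp hE with h3 | h5
  · exact .three (isPrimitiveRoot_three_iff.mpr h3)
  · exact .five (isPrimitiveRoot_five_iff.mpr h5)

lemma torsionZeroProduct_of_f_neg_sq_sq {x y : ℂ} (hx : x ≠ 0) (hy : y ≠ 0) (h : f x y = 0)
    (h' : f (-x ^ 2) (y ^ 2) = 0) : TorsionZeroProduct (x * y) := by
  rw [f_eq] at h h'
  have hp : 4 * (x * y) ≠ 0 := by simp [hx, hy]
  have hd : (y ^ 2 - x ^ 2) ^ 2 = (x + y) ^ 2 * ((x + y) ^ 2 - 4 * (x * y)) := by ring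
  have h'_d : (y ^ 2 - x ^ 2) * (1 + (x * y) ^ 4) = (x * y) ^ 6 - 1 := by linear_combination h'
  have h'_sq : (x + y) ^ 2 * ((x + y) ^ 2 - 4 * (x * y)) * (1 + (x * y) ^ 4) ^ 2 =
      ((x * y) ^ 6 - 1) ^ 2 := by rw [← hd, ← mul_pow, h'_d]
  clear h' h'_d hd
  generalize x * y = p at *
  generalize x + y = s at *
  have h_sq : s ^ 2 * (1 + p ^ 2) ^ 2 = (1 + p ^ 3) ^ 2 := by
    linear_combination (s * (1 + p ^ 2) - (1 + p ^ 3)) * h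
  have hE : 4 * p * ((p + 1) ^ 4 * ((p ^ 2 - p + 1) ^ 3 * ((p ^ 2 + p + 1) *
      (p ^ 6 - p ^ 5 + p ^ 4 - p ^ 3 + p ^ 2 - p + 1)))) = 0 := by
    linear_combination -(1 + p ^ 2) ^ 4 * h'_sq + (1 + p ^ 4) ^ 2 *
      (s ^ 2 * (1 + p ^ 2) ^ 2 + (1 + p ^ 3) ^ 2 - 4 * p * (1 + p ^ 2) ^ 2) * h_sq
  rcases mul_eq_zero.mp ((mul_eq_zero.mp hE).resolve_left hp) with h2 | hE
  · have h2 := pow_eq_zero_iff four_ne_zero |>.mp h2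
    exact .cube_neg_one (by linear_combination (p ^ 2 - p + 1) * h2)
  rcases mul_eq_zero.mp hE with h6 | hE
  · have h6 := pow_eq_zero_iff three_ne_zero |>.mp h6
    exact .cube_neg_one (by linear_combination (p + 1) * h6)
  rcases mul_eq_zero.mp hE with h3 | h14
  · exact .three (isPrimitiveRoot_three_iff.mpr h3)
  · exact .fourteen (isPrimitiveRoot_seven_iff.mpr (by linear_combination h14))

open Polynomial in
/-- The factor other than `2 * p` left after eliminating `x + y` from `f x y = 0` and
`f (-x ^ 2) (-y ^ 2) = 0`, as a polynomial in `p = x * y`. -/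
noncomputable def companionOctic : ℤ[X] :=
  X ^ 8 + X ^ 7 + X ^ 6 + 2 * X ^ 4 + X ^ 2 + X + 1

lemma aeval_companionOctic {K : Type*} [CommRing K] (p : K) :
    Polynomial.aeval p companionOctic =
      p ^ 8 + p ^ 7 + p ^ 6 + 2 * p ^ 4 + p ^ 2 + p + 1 := by
  simp [companionOctic, map_ofNat (Polynomial.aeval (R := ℤ) p) 2]

lemma aeval_companionOctic_eq_zero_of_f_neg_sq_neg_sq {x y : ℂ} (hx : x ≠ 0) (hy : y ≠ 0)
    (h : f x y = 0) (h' : f (-x ^ 2) (-y ^ 2) = 0) :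
    Polynomial.aeval (x * y) companionOctic = 0 := by
  rw [f_eq] at h h'
  rw [aeval_companionOctic]
  have hp : 2 * (x * y) ≠ 0 := by simp [hx, hy]
  refine (mul_eq_zero.mp ?_).resolve_left hp
  linear_combination (1 + (x * y) ^ 2) ^ 2 * h' +
    (1 + (x * y) ^ 4) * ((x + y) * (1 + (x * y) ^ 2) - (1 + (x * y) ^ 3)) * h

lemma aeval_companionOctic_eq_zero_iff {K : Type*} [Field K] {p : K} (hp : p ≠ 0) :
    Polynomial.aeval p companionOctic = 0 ↔
      (p + p⁻¹) ^ 4 + (p + p⁻¹) ^ 3 - 3 * (p + p⁻¹) ^ 2 - 3 * (p + p⁻¹) + 2 = 0 := by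
  have h_trace : Polynomial.aeval p companionOctic = p ^ 4 *
      ((p + p⁻¹) ^ 4 + (p + p⁻¹) ^ 3 - 3 * (p + p⁻¹) ^ 2 - 3 * (p + p⁻¹) + 2) := by
    rw [aeval_companionOctic]
    field_simp
    ring
  rw [h_trace, mul_eq_zero_iff_left (pow_ne_zero 4 hp)]

lemma quartic_sq_sub_two_ne_zero {K : Type*} [Field K] [CharZero K] {c : K}
    (hc : c ^ 4 + c ^ 3 - 3 * c ^ 2 - 3 * c + 2 = 0) :
    (c ^ 2 - 2) ^ 4 + (c ^ 2 - 2) ^ 3 - 3 * (c ^ 2 - 2) ^ 2 - 3 * (c ^ 2 - 2) + 2 ≠ 0 := by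
  intro h_sq
  -- The coefficients come from the extended Euclidean algorithm.
  have : (1 : K) = 0 := by
    linear_combination (11 / 8 - 5 / 8 * c - 17 / 8 * c ^ 2 - 7 / 8 * c ^ 3) * h_sq +
      (-9 / 4 - 17 / 8 * c + 21 / 4 * c ^ 2 + 33 / 8 * c ^ 3 - 23 / 4 * c ^ 4 - 33 / 8 * c ^ 5 +
        5 / 4 * c ^ 6 + 7 / 8 * c ^ 7) * hc
  exact one_ne_zero this

lemma aeval_companionOctic_ne_zero_of_odd_pow_eq_one {K : Type*} [Field K] [CharZero K] {p : K}
    {m : ℕ} (hm : Odd m) (hpm : p ^ m = 1) : Polynomial.aeval p companionOctic ≠ 0 := by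
  intro h
  have hp_fin : IsOfFinOrder p := isOfFinOrder_iff_pow_eq_one.mpr ⟨m, hm.pos, hpm⟩
  have h_coprime : Nat.Coprime 2 (orderOf p) :=
    (Nat.coprime_two_left.mpr hm).coprime_dvd_right (orderOf_dvd_of_pow_eq_one hpm)
  have h_sq := aeval_pow_eq_zero hp_fin h_coprime h
  have hp : p ≠ 0 := hp_fin.isUnit.ne_zero
  rw [aeval_companionOctic_eq_zero_iff hp] at h
  rw [aeval_companionOctic_eq_zero_iff (pow_ne_zero 2 hp)] at h_sq
  have h_trace : p ^ 2 + (p ^ 2)⁻¹ = (p + p⁻¹) ^ 2 - 2 := by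
    field_simp
    ring
  rw [h_trace] at h_sq
  exact quartic_sq_sub_two_ne_zero h h_sq

/-- The polynomial function `f` as a formal polynomial over `ℤ`, to which Galois conjugation
applies. -/
noncomputable def fPoly : MvPolynomial (Fin 2) ℤ :=
  1 + .X 0 + .X 1 + .X 0 ^ 2 * .X 1 ^ 3 + .X 0 ^ 3 * .X 1 ^ 2 + .X 0 ^ 3 * .X 1 ^ 3

lemma aeval_fPoly (z : Fin 2 → ℂ) : MvPolynomial.aeval z fPoly = f (z 0) (z 1) := by
  simp [fPoly, f]

lemma exists_companion_zero {x y : ℂ} (hx : IsOfFinOrder x) (hy : IsOfFinOrder y)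
    (h : f x y = 0) :
    ∃ a b : ℂ, (a = 1 ∨ a = -1) ∧ (b = 1 ∨ b = -1) ∧
      (¬(a = 1 ∧ b = 1) ∧ f (a * x) (b * y) = 0 ∨
        (∃ m, Odd m ∧ x ^ m = a ∧ y ^ m = b) ∧ f (a * x ^ 2) (b * y ^ 2) = 0) := by
  have hz : IsOfFinOrder ![x, y] := .pi (Fin.forall_fin_two.mpr ⟨hx, hy⟩)
  obtain ⟨ε, hε, hcomp⟩ := exists_sign_twist_aeval_eq_zero hz (P := fPoly)
    (by simpa [aeval_fPoly] using h)
  have hε_cases (i : Fin 2) : ε i = 1 ∨ ε i = -1 := sq_eq_one_iff.mp (congrFun hε i)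
  refine ⟨ε 0, ε 1, hε_cases 0, hε_cases 1, ?_⟩
  simpa [aeval_fPoly, funext_iff, Fin.forall_fin_two] using hcomp

lemma torsionZeroProduct_of_f_eq_zero {x y : ℂ} (hx : IsOfFinOrder x) (hy : IsOfFinOrder y)
    (h : f x y = 0) : TorsionZeroProduct (x * y) := by
  have hx0 : x ≠ 0 := hx.isUnit.ne_zero
  have hy0 : y ≠ 0 := hy.isUnit.ne_zero
  have h_comm : f y x = 0 := f_comm x y ▸ h
  obtain ⟨a, b, rfl | rfl, rfl | rfl, ⟨hne, h'⟩ | ⟨⟨m, hm, hxm, hym⟩, h'⟩⟩ :=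
    exists_companion_zero hx hy h <;>
    simp only [one_mul, neg_mul] at h'
  · simp at hne
  · exact torsionZeroProduct_of_f_sq_sq h h'
  · exact torsionZeroProduct_of_f_neg_right hy0 h h'
  · rw [mul_comm]
    exact torsionZeroProduct_of_f_neg_sq_sq hy0 hx0 h_comm (f_comm _ _ ▸ h')
  · rw [mul_comm]
    exact torsionZeroProduct_of_f_neg_right hx0 h_comm (f_comm _ _ ▸ h')
  · exact torsionZeroProduct_of_f_neg_sq_sq hx0 hy0 h h'
  · exact torsionZeroProduct_of_f_neg_neg h h'
  · have hxym : (x * y) ^ m = 1 := by rw [mul_pow, hxm, hym, neg_one_mul, neg_neg]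
    exact absurd (aeval_companionOctic_eq_zero_of_f_neg_sq_neg_sq hx0 hy0 h h')
      (aeval_companionOctic_ne_zero_of_odd_pow_eq_one hm hxym)

lemma isPrimitiveRoot_zeta (N : ℕ) [NeZero N] : IsPrimitiveRoot (zeta N) N :=
  Complex.isPrimitiveRoot_exp N (NeZero.ne N)

lemma zeta_pow_mod (N a : ℕ) [NeZero N] : zeta N ^ (a % N) = zeta N ^ a :=
  (pow_eq_pow_mod a (isPrimitiveRoot_zeta N).pow_eq_one).symm

lemma zeta_pow_of_mul_eq {n d N : ℕ} (hd : d ≠ 0) (h : d * n = N) : zeta N ^ d = zeta n := by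
  have hd' : (d : ℂ) ≠ 0 := mod_cast hd
  rw [← h, zeta, zeta, ← Complex.exp_nat_mul, Nat.cast_mul, mul_div_assoc',
    mul_div_mul_left _ _ hd']

lemma zeta_pow_105 : zeta 210 ^ 105 = -1 := by
  rw [zeta_pow_of_mul_eq (n := 2) (by norm_num) (by norm_num)]
  exact (isPrimitiveRoot_zeta 2).eq_neg_one_of_two_right

/-- The pair of powers of `ζ₂₁₀` with the given exponents, the parametrisation used to compare
`solutions`, `S` and `P`. -/
noncomputable def zetaPair (ab : ℕ × ℕ) : ℂ × ℂ := (zeta 210 ^ ab.1, zeta 210 ^ ab.2)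

lemma zetaPair_mod (ab : ℕ × ℕ) : zetaPair (ab.1 % 210, ab.2 % 210) = zetaPair ab := by
  simp only [zetaPair, zeta_pow_mod]

lemma image_zetaPair_eq_image_P {E : Finset (ℕ × ℕ)}
    (hE : E.image (fun ab ↦ (ab.1 % 210, ab.2 % 210)) = P) : zetaPair '' E = zetaPair '' P := by
  simp only [← hE, Finset.coe_image, Set.image_image, zetaPair_mod]

/-- Representatives of the units modulo `n`, which index the primitive `n`-th roots of unity. -/
def coprimeResidues (n : ℕ) : Finset ℕ := {i ∈ Finset.range n | i.Coprime n}

/-- The exponents with respect to `ζ₂₁₀` of the pairs in `TorsionZero`, case by case. They are not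
reduced modulo `210`: a factor `-1` contributes `105`. -/
def torsionZeroExponents : Finset (ℕ × ℕ) :=
  (Finset.range 6).image (fun i ↦ (35 * i, 105 + 35 * i)) ∪
  (coprimeResidues 3).image (fun i ↦ (70 * i, 70 * i)) ∪
  (coprimeResidues 3).image (fun i ↦ (70 * i, 70 * i * 2)) ∪
  (coprimeResidues 5 ×ˢ coprimeResidues 3).image
    (fun ij ↦ (42 * ij.1 + 70 * ij.2, 42 * ij.1 + 70 * ij.2 * 2)) ∪
  (coprimeResidues 7).image (fun i ↦ (30 * i, 105 + 30 * i * 4)) ∪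
  (coprimeResidues 7).image (fun i ↦ (105 + 30 * i * 4, 30 * i))

lemma image_mod_torsionZeroExponents :
    torsionZeroExponents.image (fun ab ↦ (ab.1 % 210, ab.2 % 210)) = P := by
  decide

lemma isPrimitiveRoot_iff_exists_zeta_pow_eq {d n : ℕ} (h : 210 = d * n) {x : ℂ} :
    IsPrimitiveRoot x n ↔ ∃ i ∈ coprimeResidues n, zeta 210 ^ (d * i) = x := by
  simp only [isPrimitiveRoot_iff_exists_pow_eq (isPrimitiveRoot_zeta 210) h, coprimeResidues,
    Finset.mem_filter, Finset.mem_range, and_assoc]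

lemma mem_image_torsionZeroExponents_iff {x y : ℂ} :
    (x, y) ∈ zetaPair '' torsionZeroExponents ↔ TorsionZero x y := by
  have h6 : IsPrimitiveRoot (zeta 210 ^ 35) 6 := (isPrimitiveRoot_zeta 210).pow (by norm_num) rfl
  have h3 {w : ℂ} := isPrimitiveRoot_iff_exists_zeta_pow_eq (d := 70) (n := 3) rfl (x := w)
  have h5 {w : ℂ} := isPrimitiveRoot_iff_exists_zeta_pow_eq (d := 42) (n := 5) rfl (x := w)
  have h7 {w : ℂ} := isPrimitiveRoot_iff_exists_zeta_pow_eq (d := 30) (n := 7) rfl (x := w)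
  simp only [torsionZeroExponents, Finset.coe_union, Finset.coe_image, Set.image_union,
    Set.image_image, zetaPair, Set.mem_union, Set.mem_image, SetLike.mem_coe, Finset.mem_product,
    Finset.mem_range, Prod.exists, Prod.mk.injEq, or_assoc, pow_add, zeta_pow_105, neg_one_mul,
    pow_mul _ (70 * _) 2, pow_mul _ (30 * _) 4]
  constructor
  · rintro (⟨i, -, rfl, rfl⟩ | ⟨i, hi, rfl, rfl⟩ | ⟨i, hi, rfl, rfl⟩ |
      ⟨i, j, ⟨hi, hj⟩, rfl, rfl⟩ | ⟨i, hi, rfl, rfl⟩ | ⟨i, hi, rfl, rfl⟩)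
    · exact .neg (by rw [pow_mul, pow_right_comm, h6.pow_eq_one, one_pow])
    · exact .diag (h3.mpr ⟨i, hi, rfl⟩)
    · exact .sq (h3.mpr ⟨i, hi, rfl⟩)
    · exact .five_three (h5.mpr ⟨i, hi, rfl⟩) (h3.mpr ⟨j, hj, rfl⟩)
    · exact .seven_left (h7.mpr ⟨i, hi, rfl⟩)
    · exact .seven_right (h7.mpr ⟨i, hi, rfl⟩)
  · rintro (hx | hx | hx | ⟨hu, hw⟩ | hx | hy)
    · obtain ⟨i, hi, rfl⟩ := h6.eq_pow_of_pow_eq_one hx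
      exact .inl ⟨i, hi, by simp only [pow_mul, and_self]⟩
    · obtain ⟨i, hi, rfl⟩ := h3.mp hx
      exact .inr <| .inl ⟨i, hi, rfl, rfl⟩
    · obtain ⟨i, hi, rfl⟩ := h3.mp hx
      exact .inr <| .inr <| .inl ⟨i, hi, rfl, rfl⟩
    · obtain ⟨i, hi, rfl⟩ := h5.mp hu
      obtain ⟨j, hj, rfl⟩ := h3.mp hw
      exact .inr <| .inr <| .inr <| .inl ⟨i, j, ⟨hi, hj⟩, rfl, rfl⟩
    · obtain ⟨i, hi, rfl⟩ := h7.mp hx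
      exact .inr <| .inr <| .inr <| .inr <| .inl ⟨i, hi, rfl, rfl⟩
    · obtain ⟨i, hi, rfl⟩ := h7.mp hy
      exact .inr <| .inr <| .inr <| .inr <| .inr ⟨i, hi, rfl, rfl⟩

lemma solutions_eq_image_zetaPair : solutions = zetaPair '' P := by
  rw [← image_zetaPair_eq_image_P image_mod_torsionZeroExponents]
  ext ⟨x, y⟩
  rw [mem_image_torsionZeroExponents_iff]
  constructor
  · rintro ⟨h, N, hN, hxN, hyN⟩
    have hx : IsOfFinOrder x := isOfFinOrder_iff_pow_eq_one.mpr ⟨N, hN, hxN⟩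
    have hy : IsOfFinOrder y := isOfFinOrder_iff_pow_eq_one.mpr ⟨N, hN, hyN⟩
    exact (torsionZeroProduct_of_f_eq_zero hx hy h).torsionZero h
  · intro h
    refine ⟨h.f_eq_zero, 210, by norm_num, ?_⟩
    obtain ⟨ab, -, ⟨⟩⟩ := mem_image_torsionZeroExponents_iff.mpr h
    simp only [← pow_mul', pow_mul, (isPrimitiveRoot_zeta 210).pow_eq_one, one_pow, and_self]

/-- The exponents with respect to `ζ₂₁₀` of the elements of `S`, in the order of its definition.
They are not reduced modulo `210`: a factor `α`, `β`, `γ` or `-1` contributes `70`, `42`, `30` or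
`105`. -/
def definingExponents : Finset (ℕ × ℕ) :=
  {(0, 105), (105, 0)} ∪
  {(70, 70), (70 * 2, 70), (70, 70 * 2), (70 * 2, 70 * 2),
   (70, 105 + 70), (105 + 70, 70), (70 * 2, 105 + 70 * 2), (105 + 70 * 2, 70 * 2)} ∪
  {(42 + 70, 42 + 70 * 2), (42 * 2 + 70, 42 * 2 + 70 * 2),
   (42 * 3 + 70, 42 * 3 + 70 * 2), (42 * 4 + 70, 42 * 4 + 70 * 2),
   (42 + 70 * 2, 42 + 70), (42 * 2 + 70 * 2, 42 * 2 + 70),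
   (42 * 3 + 70 * 2, 42 * 3 + 70), (42 * 4 + 70 * 2, 42 * 4 + 70)} ∪
  {(30, 105 + 30 * 4), (30 * 2, 105 + 30), (30 * 3, 105 + 30 * 5),
   (30 * 4, 105 + 30 * 2), (30 * 5, 105 + 30 * 6), (30 * 6, 105 + 30 * 3),
   (105 + 30, 30 * 2), (105 + 30 * 2, 30 * 4), (105 + 30 * 3, 30 * 6),
   (105 + 30 * 4, 30), (105 + 30 * 5, 30 * 3), (105 + 30 * 6, 30 * 5)}

lemma S_eq_image_zetaPair_definingExponents : S = zetaPair '' definingExponents := by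
  have hα : zeta 210 ^ 70 = α := zeta_pow_of_mul_eq (by norm_num) (by norm_num)
  have hβ : zeta 210 ^ 42 = β := zeta_pow_of_mul_eq (by norm_num) (by norm_num)
  have hγ : zeta 210 ^ 30 = γ := zeta_pow_of_mul_eq (by norm_num) (by norm_num)
  simp only [S, S₀, S₁, S₂, S₃, definingExponents, Finset.coe_union, Finset.coe_insert,
    Finset.coe_singleton, Set.image_union, Set.image_insert_eq, Set.image_singleton, zetaPair,
    pow_add, pow_mul, pow_zero, hα, hβ, hγ, zeta_pow_105, neg_one_mul]

lemma image_mod_definingExponents :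
    definingExponents.image (fun ab ↦ (ab.1 % 210, ab.2 % 210)) = P := by
  decide

lemma S_eq_image_zetaPair : S = zetaPair '' P := by
  rw [S_eq_image_zetaPair_definingExponents, image_zetaPair_eq_image_P image_mod_definingExponents]

lemma zetaPair_injOn_P : Set.InjOn zetaPair P := by
  have hlt : ∀ ab ∈ P, ab.1 < 210 ∧ ab.2 < 210 := by decide
  have hζ := isPrimitiveRoot_zeta 210
  intro ab hab cd hcd h
  exact Prod.ext
    (hζ.pow_inj (hlt ab hab).1 (hlt cd hcd).1 (congrArg Prod.fst h))
    (hζ.pow_inj (hlt ab hab).2 (hlt cd hcd).2 (congrArg Prod.snd h))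

lemma card_P : P.card = 30 := by decide

end Sharygin

theorem mainTheorem1 :
    Sharygin.solutions = Sharygin.S ∧
    Sharygin.S.ncard = 30 ∧
    Sharygin.P.card = 30 ∧
    Sharygin.solutions =
      {p : ℂ × ℂ | ∃ ab ∈ Sharygin.P,
        p = (Sharygin.zeta 210 ^ ab.1, Sharygin.zeta 210 ^ ab.2)} := by
  refine ⟨?_, ?_, Sharygin.card_P, ?_⟩
  · rw [Sharygin.solutions_eq_image_zetaPair, Sharygin.S_eq_image_zetaPair]
  · rw [Sharygin.S_eq_image_zetaPair, Sharygin.zetaPair_injOn_P.ncard_image,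
      Set.ncard_coe_finset, Sharygin.card_P]
  · rw [Sharygin.solutions_eq_image_zetaPair]
    ext p
    simp only [Set.mem_image, Set.mem_ofPred_eq, SetLike.mem_coe, Sharygin.zetaPair, eq_comm]
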